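/- Let $K$ be a field with an involution $k\mapsto\overline{k}$, that is, an additive map with $\overline{kl}=\overline{l}\,\overline{k}$ and $\overline{\overline{k}}=k$. A graph $E=(E^0,E^1,r,s)$ consists of arbitrary sets $E^0$ of vertices and $E^1$ of edges and maps $r,s:E^1\to E^0$. The Leavitt path algebra $L_K(E)$ is the associative, not necessarily unital, $K$-algebra generated by $E^0\cup E^1\cup\{e^*\mid e\in E^1\}$ with the relations - (V) $vw=\delta_{v,w}v$ for all $v,w\in E^0$; - (P1) $s(e)e=er(e)=e$ for all $e\in E^1$; - (P2) $r(e)e^*=e^*s(e)=e^*$ for all $e\in E^1$; - (CK1) $e^*f=\delta_{e,f}r(e)$ for all $e,f\in E^1$; - (CK2) $v=\sum_{e\in s^{-1}(v)}ee^*$ for every $v\in E^0$ such that $s^{-1}(v)$ is finite and nonempty. It carries the involution induced by that of $K$, namely $\left(\sum_i k_ip_iq_i^*\right)^*=\sum_i\overline{k_i}\,q_ip_i^*$ for $k_i\in K$ and paths $p_i,q_i$ in $E$; here a path is a vertex, with $v^*=v$, or a sequence of edges $e_1\cdots e_m$ with $r(e_i)=s(e_{i+1})$, with $(e_1\cdots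 e_m)^*=e_m^*\cdots e_1^*$. An involution $*$ on a ring $R$ is called positive definite if for every positive integer $n$ and all $x_1,\dots,x_n\in R$, $x_1^*x_1+\dots+x_n^*x_n=0$ implies $x_1=\dots=x_n=0$. **Proposition 2.4.** The following conditions are equivalent: 1. The involution on $K$ is positive definite. 2. The involution on $L_K(E)$ is positive definite for every graph $E$. 3. The involution on $L_K(E)$ is positive definite for some graph $E$ with $E^0\neq\emptyset$. Thus, if $E$ is an arbitrary graph with $E^0\neq\emptyset$, then $L_K(E)$ is positive definite if and only if $K$ is positive definite. -/

import Mathlib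

universe u v w

/-- A directed graph: a type of vertices, a type of edges, and source and range maps. -/
structure DirectedGraph where
  /-- The vertices `E⁰`. -/
  Vertex : Type u
  /-- The edges `E¹`. -/
  Edge : Type v
  /-- The source map `s`. -/
  source : Edge → Vertex
  /-- The range map `r`. -/
  range : Edge → Vertex

/-- The involution of `R` is `n`-proper:
`x₁⋆ x₁ + ⋯ + xₙ⋆ xₙ = 0` implies `x₁ = ⋯ = xₙ = 0`. -/
def IsNProper (n : ℕ) (R : Type w) [NonUnitalRing R] [StarRing R] : Prop :=
  ∀ x : Fin n → R, ∑ i, star (x i) * x i = 0 → ∀ i, x i = 0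

/-- The involution of `R` is positive definite: `n`-proper for every positive integer `n`. -/
def IsPositiveDefinite (R : Type w) [NonUnitalRing R] [StarRing R] : Prop :=
  ∀ n : ℕ, 0 < n → IsNProper n R

namespace LeavittPath

/-- The generating set `E⁰ ∪ E¹ ∪ {e⋆ | e ∈ E¹}` (disjoint union). -/
inductive Generator (E : DirectedGraph.{u, v}) : Type (max u v)
  | vertex (x : E.Vertex) : Generator E
  | edge (e : E.Edge) : Generator E
  | ghost (e : E.Edge) : Generator E

/-- The formal adjoint of a generator: vertices are fixed, `e` and `e⋆` are exchanged. -/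
def Generator.adjoint {E : DirectedGraph.{u, v}} : Generator E → Generator E
  | .vertex x => .vertex x
  | .edge e => .ghost e
  | .ghost e => .edge e

theorem Generator.adjoint_adjoint {E : DirectedGraph.{u, v}} (g : Generator E) :
    g.adjoint.adjoint = g := by
  cases g <;> rfl

/-- Reversal of words, replacing every letter by its adjoint. -/
def wordAdjoint {E : DirectedGraph.{u, v}} (p : FreeSemigroup (Generator E)) :
    FreeSemigroup (Generator E) :=
  (FreeSemigroup.lift (fun g => MulOpposite.op (FreeSemigroup.of g.adjoint)) p).unop

theorem wordAdjoint_of {E : DirectedGraph.{u, v}} (g : Generator E) :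
    wordAdjoint (FreeSemigroup.of g) = FreeSemigroup.of g.adjoint := rfl

theorem wordAdjoint_mul {E : DirectedGraph.{u, v}} (p q : FreeSemigroup (Generator E)) :
    wordAdjoint (p * q) = wordAdjoint q * wordAdjoint p := by
  simp [wordAdjoint]

theorem wordAdjoint_wordAdjoint {E : DirectedGraph.{u, v}} (p : FreeSemigroup (Generator E)) :
    wordAdjoint (wordAdjoint p) = p := by
  induction p using FreeSemigroup.recOnMul with
  | ih1 g => rw [wordAdjoint_of, wordAdjoint_of, Generator.adjoint_adjoint]
  | ih2 g p hg hp => rw [wordAdjoint_mul, wordAdjoint_mul, hg, hp]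

/-- The free associative, not necessarily unital, `K`-algebra on the generators: its basis is
the set of nonempty words in the generators. -/
abbrev FreeAlg (K : Type w) [Field K] (E : DirectedGraph.{u, v}) : Type (max u v w) :=
  MonoidAlgebra K (FreeSemigroup (Generator E))

noncomputable section

section Relations

variable (K : Type w) [Field K] {E : DirectedGraph.{u, v}}

/-- A generator as an element of the free algebra. -/
def gen (g : Generator E) : FreeAlg K E := MonoidAlgebra.single (FreeSemigroup.of g) 1

/-- The vertex `x` as an element of the free algebra. -/
abbrev vtx (x : E.Vertex) : FreeAlg K E := gen K (.vertex x)

/-- The edge `e` as an element of the free algebra. -/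
abbrev edg (e : E.Edge) : FreeAlg K E := gen K (.edge e)

/-- The ghost edge `e⋆` as an element of the free algebra. -/
abbrev gho (e : E.Edge) : FreeAlg K E := gen K (.ghost e)

/-- The defining relations (V), (P1), (P2), (CK1), (CK2) of the Leavitt path algebra. -/
inductive Rel : FreeAlg K E → FreeAlg K E → Prop
  | vertex_self (x : E.Vertex) : Rel (vtx K x * vtx K x) (vtx K x)
  | vertex_ne (x y : E.Vertex) (h : x ≠ y) : Rel (vtx K x * vtx K y) 0
  | source_edge (e : E.Edge) : Rel (vtx K (E.source e) * edg K e) (edg K e)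
  | edge_range (e : E.Edge) : Rel (edg K e * vtx K (E.range e)) (edg K e)
  | range_ghost (e : E.Edge) : Rel (vtx K (E.range e) * gho K e) (gho K e)
  | ghost_source (e : E.Edge) : Rel (gho K e * vtx K (E.source e)) (gho K e)
  | ck1_self (e : E.Edge) : Rel (gho K e * edg K e) (vtx K (E.range e))
  | ck1_ne (e f : E.Edge) (h : e ≠ f) : Rel (gho K e * edg K f) 0
  | ck2 (x : E.Vertex) (hfin : {e : E.Edge | E.source e = x}.Finite)
      (hne : {e : E.Edge | E.source e = x}.Nonempty) :
      Rel (vtx K x) (∑ e ∈ hfin.toFinset, edg K e * gho K e)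

/-- A ring congruence on the free algebra that is compatible with scalars and contains the
defining relations. -/
def IsAdmissible (c : RingCon (FreeAlg K E)) : Prop :=
  (∀ (k : K) (a b : FreeAlg K E), c a b → c (k • a) (k • b)) ∧
    ∀ a b : FreeAlg K E, Rel K a b → c a b

variable (E) in
/-- The smallest `K`-algebra congruence containing the defining relations. -/
def con : RingCon (FreeAlg K E) := sInf {c | IsAdmissible K c}

theorem con_iff {a b : FreeAlg K E} :
    con K E a b ↔ ∀ c : RingCon (FreeAlg K E), IsAdmissible K c → c a b := Iff.rfl

theorem con_isAdmissible : IsAdmissible K (con K E) :=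
  ⟨fun k _ _ h c hc => hc.1 k _ _ (h c hc), fun _ _ h _ hc => hc.2 _ _ h⟩

end Relations

section FreeAdjoint

variable {K : Type w} [Field K] [StarRing K] {E : DirectedGraph.{u, v}}

/-- The conjugate-linear map of the free algebra that sends a word to its adjoint. -/
def freeAdjoint (a : FreeAlg K E) : FreeAlg K E :=
  MonoidAlgebra.ofCoeff ((a.coeff.mapRange star (star_zero K)).mapDomain wordAdjoint)

theorem freeAdjoint_single (p : FreeSemigroup (Generator E)) (k : K) :
    freeAdjoint (MonoidAlgebra.single p k : FreeAlg K E) =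
      MonoidAlgebra.single (wordAdjoint p) (star k) := by
  simp [freeAdjoint, Finsupp.mapDomain_single]

theorem freeAdjoint_zero : freeAdjoint (0 : FreeAlg K E) = 0 := by
  simp [freeAdjoint]

theorem freeAdjoint_add (a b : FreeAlg K E) :
    freeAdjoint (a + b) = freeAdjoint a + freeAdjoint b := by
  simp [freeAdjoint, Finsupp.mapRange_add (hf := star_zero K) star_add, Finsupp.mapDomain_add]

theorem freeAdjoint_freeAdjoint (a : FreeAlg K E) : freeAdjoint (freeAdjoint a) = a := by
  induction a using MonoidAlgebra.induction_linear with
  | zero => simp [freeAdjoint_zero]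
  | add a b ha hb => rw [freeAdjoint_add, freeAdjoint_add, ha, hb]
  | single p k => rw [freeAdjoint_single, freeAdjoint_single, wordAdjoint_wordAdjoint, star_star]

theorem freeAdjoint_mul (a b : FreeAlg K E) :
    freeAdjoint (a * b) = freeAdjoint b * freeAdjoint a := by
  induction a using MonoidAlgebra.induction_linear with
  | zero => simp [freeAdjoint_zero]
  | add a a' ha ha' => rw [add_mul, freeAdjoint_add, ha, ha', freeAdjoint_add, mul_add]
  | single p k =>
    induction b using MonoidAlgebra.induction_linear with
    | zero => simp [freeAdjoint_zero]
    | add b b' hb hb' => rw [mul_add, freeAdjoint_add, hb, hb', freeAdjoint_add, add_mul]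
    | single q l =>
      simp only [MonoidAlgebra.single_mul_single, freeAdjoint_single, wordAdjoint_mul, star_mul]

theorem freeAdjoint_smul (k : K) (a : FreeAlg K E) :
    freeAdjoint (k • a) = star k • freeAdjoint a := by
  induction a using MonoidAlgebra.induction_linear with
  | zero => simp [freeAdjoint_zero]
  | add a b ha hb => rw [smul_add, freeAdjoint_add, ha, hb, freeAdjoint_add, smul_add]
  | single p l => simp [MonoidAlgebra.smul_single, freeAdjoint_single]

theorem freeAdjoint_gen (g : Generator E) : freeAdjoint (gen K g) = gen K g.adjoint := by
  rw [gen, gen, freeAdjoint_single, star_one, wordAdjoint_of]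

theorem freeAdjoint_sum {ι : Type*} (s : Finset ι) (f : ι → FreeAlg K E) :
    freeAdjoint (∑ i ∈ s, f i) = ∑ i ∈ s, freeAdjoint (f i) :=
  map_sum (AddMonoidHom.mk' (freeAdjoint (K := K) (E := E)) freeAdjoint_add) f s

/-- The adjoints of the defining relations are again defining relations. -/
theorem rel_freeAdjoint {a b : FreeAlg K E} (h : Rel K a b) :
    Rel K (freeAdjoint a) (freeAdjoint b) := by
  cases h <;> simp only [freeAdjoint_mul, freeAdjoint_gen, freeAdjoint_zero, freeAdjoint_sum,
    Generator.adjoint]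
  · exact .vertex_self _
  · exact .vertex_ne _ _ (Ne.symm ‹_›)
  · exact .ghost_source _
  · exact .range_ghost _
  · exact .edge_range _
  · exact .source_edge _
  · exact .ck1_self _
  · exact .ck1_ne _ _ (Ne.symm ‹_›)
  · exact .ck2 _ _ ‹_›

theorem con_freeAdjoint {a b : FreeAlg K E} (h : con K E a b) :
    con K E (freeAdjoint a) (freeAdjoint b) := by
  intro c hc
  let d : RingCon (FreeAlg K E) :=
    { r := fun a b => c (freeAdjoint a) (freeAdjoint b)
      iseqv := ⟨fun _ => c.refl _, fun h => c.symm h, fun h h' => c.trans h h'⟩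
      add' := fun h h' => by
        simp only [freeAdjoint_add]; exact c.add h h'
      mul' := fun h h' => by
        simp only [freeAdjoint_mul]; exact c.mul h' h }
  have hd : IsAdmissible K d := by
    refine ⟨fun k a b hab => ?_, fun a b hab => hc.2 _ _ (rel_freeAdjoint hab)⟩
    change c (freeAdjoint (k • a)) (freeAdjoint (k • b))
    rw [freeAdjoint_smul, freeAdjoint_smul]
    exact hc.1 _ _ _ hab
  exact h d hd

end FreeAdjoint

end

end LeavittPath

/-- The Leavitt path algebra `L_K(E)`: the (not necessarily unital) associative `K`-algebra
generated by `E⁰ ∪ E¹ ∪ {e⋆ | e ∈ E¹}` with the relations (V), (P1), (P2), (CK1), (CK2). -/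
def LeavittPathAlgebra (K : Type w) [Field K] (E : DirectedGraph.{u, v}) : Type (max u v w) :=
  (LeavittPath.con K E).Quotient

namespace LeavittPathAlgebra

open LeavittPath

noncomputable section

variable {K : Type w} [Field K] {E : DirectedGraph.{u, v}}

instance : NonUnitalRing (LeavittPathAlgebra K E) :=
  inferInstanceAs (NonUnitalRing (LeavittPath.con K E).Quotient)

/-- The quotient map from the free algebra. -/
def mk : FreeAlg K E → LeavittPathAlgebra K E := fun a => (a : (LeavittPath.con K E).Quotient)

theorem mk_surjective : Function.Surjective (mk : FreeAlg K E → LeavittPathAlgebra K E) :=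
  Quotient.mk_surjective

theorem mk_eq_mk {a b : FreeAlg K E} :
    (mk a : LeavittPathAlgebra K E) = mk b ↔ LeavittPath.con K E a b :=
  RingCon.eq _

theorem mk_zero : (mk 0 : LeavittPathAlgebra K E) = 0 := rfl

theorem mk_add (a b : FreeAlg K E) : (mk (a + b) : LeavittPathAlgebra K E) = mk a + mk b := rfl

theorem mk_mul (a b : FreeAlg K E) : (mk (a * b) : LeavittPathAlgebra K E) = mk a * mk b := rfl

instance : SMul K (LeavittPathAlgebra K E) where
  smul k := Quotient.map' (k • ·) fun _ _ h => (con_isAdmissible K).1 k _ _ h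

theorem mk_smul (k : K) (a : FreeAlg K E) :
    (mk (k • a) : LeavittPathAlgebra K E) = k • mk a := rfl

instance : Module K (LeavittPathAlgebra K E) where
  one_smul x := by
    obtain ⟨a, rfl⟩ := mk_surjective x
    rw [← mk_smul, one_smul]
  mul_smul k l x := by
    obtain ⟨a, rfl⟩ := mk_surjective x
    rw [← mk_smul, ← mk_smul, ← mk_smul, mul_smul]
  smul_zero k := by rw [← mk_zero, ← mk_smul, smul_zero]
  smul_add k x y := by
    obtain ⟨a, rfl⟩ := mk_surjective x
    obtain ⟨b, rfl⟩ := mk_surjective y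
    rw [← mk_add, ← mk_smul, ← mk_smul, ← mk_smul, ← mk_add, smul_add]
  add_smul k l x := by
    obtain ⟨a, rfl⟩ := mk_surjective x
    rw [← mk_smul, ← mk_smul, ← mk_smul, ← mk_add, add_smul]
  zero_smul x := by
    obtain ⟨a, rfl⟩ := mk_surjective x
    rw [← mk_smul, zero_smul, mk_zero]

instance : IsScalarTower K (LeavittPathAlgebra K E) (LeavittPathAlgebra K E) where
  smul_assoc k x y := by
    obtain ⟨a, rfl⟩ := mk_surjective x
    obtain ⟨b, rfl⟩ := mk_surjective y
    simp only [smul_eq_mul]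
    rw [← mk_smul, ← mk_mul, ← mk_mul, ← mk_smul, smul_mul_assoc]

instance : SMulCommClass K (LeavittPathAlgebra K E) (LeavittPathAlgebra K E) where
  smul_comm k x y := by
    obtain ⟨a, rfl⟩ := mk_surjective x
    obtain ⟨b, rfl⟩ := mk_surjective y
    simp only [smul_eq_mul]
    rw [← mk_smul, ← mk_mul, ← mk_mul, ← mk_smul, mul_smul_comm]

section Involution

variable [StarRing K]

instance : Star (LeavittPathAlgebra K E) where
  star := Quotient.map' freeAdjoint fun _ _ h => con_freeAdjoint h

theorem star_mk (a : FreeAlg K E) :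
    star (mk a : LeavittPathAlgebra K E) = mk (freeAdjoint a) := rfl

/-- The involution of `L_K(E)` induced by the involution of `K`: the conjugate-linear
anti-automorphism fixing the vertices and exchanging `e` and `e⋆`; hence it maps
`∑ kᵢ pᵢ qᵢ⋆` to `∑ (star kᵢ) qᵢ pᵢ⋆`. -/
instance : StarRing (LeavittPathAlgebra K E) where
  star_involutive x := by
    obtain ⟨a, rfl⟩ := mk_surjective x
    rw [star_mk, star_mk, freeAdjoint_freeAdjoint]
  star_mul x y := by
    obtain ⟨a, rfl⟩ := mk_surjective x
    obtain ⟨b, rfl⟩ := mk_surjective y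
    rw [← mk_mul, star_mk, star_mk, star_mk, ← mk_mul, freeAdjoint_mul]
  star_add x y := by
    obtain ⟨a, rfl⟩ := mk_surjective x
    obtain ⟨b, rfl⟩ := mk_surjective y
    rw [← mk_add, star_mk, star_mk, star_mk, ← mk_add, freeAdjoint_add]

instance : StarModule K (LeavittPathAlgebra K E) where
  star_smul k x := by
    obtain ⟨a, rfl⟩ := mk_surjective x
    rw [← mk_smul, star_mk, star_mk, ← mk_smul, freeAdjoint_smul]

theorem star_mk_gen (g : Generator E) :
    star (mk (gen K g) : LeavittPathAlgebra K E) = mk (gen K g.adjoint) := by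
  rw [star_mk, freeAdjoint_gen]

end Involution

end

end LeavittPathAlgebra

/-! Let `V` be the `K`-space whose basis consists of the boundary paths, each carrying an integer
degree. An edge acts by prepending itself, a ghost edge by removing a first letter, a vertex by
projecting onto the paths that start there. Every generator is a partial injection of the basis
whose partial inverse is its adjoint, so `a⋆` acts as the adjoint of `a` for the form with
orthonormal basis (`isAdjointPair_rep`). If `∑ aᵢ⋆ aᵢ = 0`, the diagonal coefficient at a basis
vector `x` is the sum of `star c * c` over all coefficients `c` of all the `aᵢ x`. Positive
definiteness of `K` makes every `c` vanish, so each `aᵢ` acts as zero (`rep_eq_zero_of_sum`).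

It remains to see that the representation is faithful (`eq_zero_of_rep_eq_zero`). One special edge
is chosen at each regular vertex. By (CK2) the algebra is spanned by the monomials `p q⋆` in which
`p` and `q` do not both end with the same special edge (`monomial_mem_span_reduced`). In a vanishing
combination take a term `p q⋆` with `q` shortest, let `t` be the special boundary path from the
common range, and read off the coefficient of `p t` in the image of `q t`. Another term `p' q'⋆`
contributes only if `p' = p m` and `q' = q m` with `m` an initial part of `t`; all edges of `m` are
special, so `m` is empty. The degree ensures that the same `m` occurs on both sides: without it, a
loop `e` that is the only edge at its vertex would act on `eee⋯` as the vertex does.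

Conversely, a vertex `y` is nonzero in the algebra, and `(k y)⋆ (k y) = (star k * k) y` carries
positive definiteness back to `K`. -/

namespace DirectedGraph

/-! ### Special edges and boundary paths -/

variable (E : DirectedGraph.{u, v})

/-- A vertex is regular if it emits at least one and at most finitely many edges. -/
def IsRegular (x : E.Vertex) : Prop :=
  {e : E.Edge | E.source e = x}.Finite ∧ {e : E.Edge | E.source e = x}.Nonempty

/-- An edge is special if it is the edge chosen among those emitted by a regular vertex. -/
def IsSpecial (e : E.Edge) : Prop :=
  ∃ h : E.IsRegular (E.source e), h.2.some = e

variable {E}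

theorem IsRegular.source_some {x : E.Vertex} (h : E.IsRegular x) : E.source h.2.some = x :=
  h.2.some_mem

theorem IsRegular.isSpecial_some {x : E.Vertex} (h : E.IsRegular x) : E.IsSpecial h.2.some := by
  -- The chosen edge depends on a regularity proof for its vertex, so the vertex is generalised
  -- before the equality is substituted.
  have key : ∀ y (hy : y = x) (hr : E.IsRegular y), hr.2.some = h.2.some := by
    rintro y rfl hr; rfl
  exact ⟨h.source_some.symm ▸ h, key _ h.source_some (h.source_some.symm ▸ h)⟩

theorem IsSpecial.eq_of_source_eq {e f : E.Edge} (he : E.IsSpecial e) (hf : E.IsSpecial f)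
    (h : E.source e = E.source f) : e = f := by
  obtain ⟨he, he'⟩ := he
  obtain ⟨hf, hf'⟩ := hf
  rw [← he', ← hf']
  congr 1
  rw [h]

/-- The source of a letter of a boundary path; a vertex is a letter that marks the end. -/
def letterSource : E.Edge ⊕ E.Vertex → E.Vertex := Sum.elim E.source id

/-- The range of a letter of a boundary path. -/
def letterRange : E.Edge ⊕ E.Vertex → E.Vertex := Sum.elim E.range id

variable (E) in
/-- Boundary paths, that is, infinite paths and paths ending in a singular vertex (continued
arbitrarily), together with an integer degree. -/
@[ext]
structure BoundaryPath where
  /-- The letters of the path. -/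
  letters : Stream' (E.Edge ⊕ E.Vertex)
  /-- Consecutive letters are composable. -/
  composable : ∀ n, letterRange (letters.get n) = letterSource (letters.get (n + 1))
  /-- A path may stop only in a singular vertex. -/
  singular : ∀ n x, letters.get n = .inr x → ¬ E.IsRegular x
  /-- The degree. -/
  degree : ℤ

namespace BoundaryPath

/-- The vertex where a boundary path starts. -/
def source (x : E.BoundaryPath) : E.Vertex := letterSource x.letters.head

/-- Prepend an edge. -/
def cons (e : E.Edge) (x : E.BoundaryPath) (h : x.source = E.range e) : E.BoundaryPath where
  letters := Stream'.cons (.inl e) x.letters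
  composable
    | 0 => h.symm
    | n + 1 => x.composable n
  singular
    | 0, _, h' => nomatch h'
    | n + 1, y, h' => x.singular n y h'
  degree := x.degree + 1

/-- Remove the first letter. -/
def tail (x : E.BoundaryPath) : E.BoundaryPath where
  letters := x.letters.tail
  composable n := x.composable (n + 1)
  singular n := x.singular (n + 1)
  degree := x.degree - 1

theorem source_cons (e : E.Edge) (x : E.BoundaryPath) (h : x.source = E.range e) :
    (cons e x h).source = E.source e := rfl

theorem source_tail {e : E.Edge} {x : E.BoundaryPath} (h : x.letters.head = .inl e) :
    x.tail.source = E.range e := by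
  have := x.composable 0
  rw [show x.letters.get 0 = .inl e from h] at this
  exact this.symm

theorem source_eq {e : E.Edge} {x : E.BoundaryPath} (h : x.letters.head = .inl e) :
    x.source = E.source e := by
  rw [source, h]; rfl

theorem tail_cons (e : E.Edge) (x : E.BoundaryPath) (h : x.source = E.range e) :
    (cons e x h).tail = x := by
  ext1
  · rfl
  · simp [cons, tail]

theorem cons_tail {e : E.Edge} {x : E.BoundaryPath} (h : x.letters.head = .inl e) :
    cons e x.tail (source_tail h) = x := by
  ext1
  · simp only [cons, tail]
    rw [← h]; exact Stream'.eta _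
  · simp [cons, tail]

/-- Boundary paths may stop only in singular vertices; this is what makes (CK2) hold in the
representation. -/
theorem exists_head_eq {x : E.BoundaryPath} (h : E.IsRegular x.source) :
    ∃ e, x.letters.head = .inl e := by
  rcases hx : x.letters.head with e | y
  · exact ⟨e, rfl⟩
  · have : x.source = y := by rw [source, hx]; rfl
    exact absurd (this ▸ h) (x.singular 0 y hx)

open Classical in
/-- The first letter of the special boundary path that starts in a given vertex. -/
noncomputable def specialLetter (y : E.Vertex) : E.Edge ⊕ E.Vertex :=
  if h : E.IsRegular y then .inl h.2.some else .inr y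

theorem letterSource_specialLetter (y : E.Vertex) : letterSource (specialLetter y) = y := by
  unfold specialLetter
  split_ifs with h
  · exact h.source_some
  · rfl

theorem isSpecial_of_specialLetter_eq {y : E.Vertex} {e : E.Edge}
    (h : specialLetter y = .inl e) : E.IsSpecial e := by
  unfold specialLetter at h
  split_ifs at h with hy
  · cases h; exact hy.isSpecial_some

/-- The boundary path from a given vertex that follows special edges until it reaches a singular
vertex. -/
noncomputable def special (y : E.Vertex) (n : ℤ) : E.BoundaryPath where
  letters := Stream'.iterate (fun a => specialLetter (letterRange a)) (specialLetter y)
  composable n := (letterSource_specialLetter _).symm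
  singular n x h hx := by
    have key : ∀ z, specialLetter z = .inr x → ¬ E.IsRegular x := by
      intro z hz
      unfold specialLetter at hz
      split_ifs at hz with hzr
      cases hz; exact hzr
    cases n with
    | zero => exact key _ h hx
    | succ n => exact key _ h hx
  degree := n

theorem source_special (y : E.Vertex) (n : ℤ) : (special y n).source = y :=
  letterSource_specialLetter y

theorem isSpecial_of_get_special {y : E.Vertex} {m : ℤ} {n : ℕ} {e : E.Edge}
    (h : (special y m).letters.get n = .inl e) : E.IsSpecial e := by
  cases n with
  | zero => exact isSpecial_of_specialLetter_eq h
  | succ n => exact isSpecial_of_specialLetter_eq h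

end BoundaryPath

end DirectedGraph

/-! ### The action of the generators and the defining relations -/

namespace LeavittPath

open DirectedGraph

variable {E : DirectedGraph.{u, v}}

open Classical in
/-- The partial action of the generators on boundary paths. -/
noncomputable def Generator.act : Generator E → E.BoundaryPath → Option E.BoundaryPath
  | .vertex y, x => if x.source = y then some x else none
  | .edge e, x => if h : x.source = E.range e then some (x.cons e h) else none
  | .ghost e, x => if x.letters.head = .inl e then some x.tail else none

/-- Prepending and removing an edge are mutually inverse. This is the combinatorial source of the
adjointness of `a` and `a⋆`. -/
theorem Generator.act_adjoint (g : Generator E) {x y : E.BoundaryPath} (h : g.act x = some y) :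
    g.adjoint.act y = some x := by
  cases g with
  | vertex z =>
    simp only [act, Option.ite_none_right_eq_some, Option.some.injEq] at h
    obtain ⟨h, rfl⟩ := h
    simp [act, adjoint, h]
  | edge e =>
    simp only [act, Option.dite_none_right_eq_some, Option.some.injEq] at h
    obtain ⟨h, rfl⟩ := h
    simp only [act, adjoint, BoundaryPath.tail_cons]
    exact if_pos rfl
  | ghost e =>
    simp only [act, Option.ite_none_right_eq_some, Option.some.injEq] at h
    obtain ⟨h, rfl⟩ := h
    simp only [act, adjoint, BoundaryPath.cons_tail h]
    exact dif_pos (BoundaryPath.source_tail h)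

theorem Generator.act_adjoint_iff (g : Generator E) {x y : E.BoundaryPath} :
    g.adjoint.act y = some x ↔ g.act x = some y :=
  ⟨fun h => by simpa only [adjoint_adjoint] using g.adjoint.act_adjoint h, g.act_adjoint⟩

noncomputable section

variable (K : Type w) [Field K]

/-- The linear operator given by a partial map of the basis. -/
def partialOp {X : Type*} (f : X → Option X) : Module.End K (X →₀ K) :=
  Finsupp.linearCombination K fun x => (f x).elim 0 fun y => Finsupp.single y 1

theorem partialOp_single {X : Type*} (f : X → Option X) (x : X) :
    partialOp K f (Finsupp.single x 1) = (f x).elim 0 fun y => Finsupp.single y 1 := by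
  simp [partialOp]

variable {K} in
theorem partialOp_single_some {X : Type*} {f : X → Option X} {x y : X} (h : f x = some y) :
    partialOp K f (Finsupp.single x 1) = Finsupp.single y 1 := by
  rw [partialOp_single, h]; rfl

variable {K} in
theorem partialOp_single_none {X : Type*} {f : X → Option X} {x : X} (h : f x = none) :
    partialOp K f (Finsupp.single x 1) = 0 := by
  rw [partialOp_single, h]; rfl

/-- The representation of the free algebra on the space spanned by the boundary paths. -/
def freeRep (E : DirectedGraph.{u, v}) : FreeAlg K E →ₙₐ[K] Module.End K (E.BoundaryPath →₀ K) :=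
  MonoidAlgebra.liftMagma K (FreeSemigroup.lift fun g => partialOp K g.act)

theorem freeRep_gen (g : Generator E) : freeRep K E (gen K g) = partialOp K g.act := by
  simp [freeRep, gen]

theorem freeRep_rel {a b : FreeAlg K E} (h : Rel K a b) : freeRep K E a = freeRep K E b := by
  classical
  refine Finsupp.lhom_ext' fun x => LinearMap.ext_ring ?_
  simp only [LinearMap.comp_apply, Finsupp.lsingle_apply]
  cases h with
  | vertex_self y =>
    by_cases hx : x.source = y <;>
      simp [freeRep_gen, partialOp_single, Generator.act, hx]
  | vertex_ne y z hyz =>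
    by_cases hx : x.source = z
    · subst hx; simp [freeRep_gen, partialOp_single, Generator.act, hyz.symm]
    · simp [freeRep_gen, partialOp_single, Generator.act, hx]
  | source_edge e =>
    by_cases hx : x.source = E.range e <;>
      simp [freeRep_gen, partialOp_single, Generator.act, hx, BoundaryPath.source_cons]
  | edge_range e =>
    by_cases hx : x.source = E.range e <;>
      simp [freeRep_gen, partialOp_single, Generator.act, hx]
  | range_ghost e =>
    by_cases hx : x.letters.head = .inl e
    · simp [freeRep_gen, partialOp_single, Generator.act, hx, BoundaryPath.source_tail hx]
    · simp [freeRep_gen, partialOp_single, Generator.act, hx]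
  | ghost_source e =>
    by_cases hx : x.letters.head = .inl e
    · simp [freeRep_gen, partialOp_single, Generator.act, hx, BoundaryPath.source_eq hx]
    · by_cases hs : x.source = E.source e <;>
        simp [freeRep_gen, partialOp_single, Generator.act, hx, hs]
  | ck1_self e =>
    by_cases hx : x.source = E.range e
    · have : (x.cons e hx).letters.head = .inl e := rfl
      simp [freeRep_gen, partialOp_single, Generator.act, hx, this, BoundaryPath.tail_cons]
    · simp [freeRep_gen, partialOp_single, Generator.act, hx]
  | ck1_ne e f hef =>
    by_cases hx : x.source = E.range f
    · have : (x.cons f hx).letters.head = .inl f := rfl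
      simp [freeRep_gen, partialOp_single, Generator.act, hx, this, hef.symm]
    · simp [freeRep_gen, partialOp_single, Generator.act, hx]
  | ck2 y hfin hne =>
    -- The element `e e⋆` acts as the projection onto the boundary paths with first letter `e`.
    have key : ∀ e : E.Edge, freeRep K E (edg K e * gho K e) (Finsupp.single x 1) =
        if x.letters.head = .inl e then Finsupp.single x 1 else 0 := by
      intro e
      split_ifs with hx
      · simp [freeRep_gen, partialOp_single, Generator.act, hx, BoundaryPath.source_tail hx,
          BoundaryPath.cons_tail hx]
      · simp [freeRep_gen, partialOp_single, Generator.act, hx]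
    rw [map_sum, LinearMap.sum_apply, Finset.sum_congr rfl fun e _ => key e]
    by_cases hx : x.source = y
    · subst hx
      -- As `x` starts in a regular vertex, its first letter is an edge, and exactly one of the
      -- projections fixes `x`.
      obtain ⟨e, he⟩ := BoundaryPath.exists_head_eq ⟨hfin, hne⟩
      rw [Finset.sum_eq_single e]
      · simp [freeRep_gen, partialOp_single, Generator.act, he]
      · intro f _ hf
        rw [if_neg]
        rw [he]; simpa using hf.symm
      · intro h
        exact absurd (hfin.mem_toFinset.2 (BoundaryPath.source_eq he).symm) h
    · rw [Finset.sum_eq_zero]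
      · simp [freeRep_gen, partialOp_single, Generator.act, hx]
      · intro e he
        rw [if_neg]
        intro h
        exact hx ((BoundaryPath.source_eq h).trans (hfin.mem_toFinset.1 he))

/-- The kernel congruence of the representation is admissible, and `con` is the smallest admissible
congruence. -/
theorem freeRep_con {a b : FreeAlg K E} (h : con K E a b) : freeRep K E a = freeRep K E b := by
  let c : RingCon (FreeAlg K E) :=
    { r := fun a b => freeRep K E a = freeRep K E b
      iseqv := ⟨fun _ => rfl, fun h => h.symm, fun h h' => h.trans h'⟩
      add' := fun h h' => by simp only [map_add, h, h']
      mul' := fun h h' => by simp only [map_mul, h, h'] }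
  refine h c ⟨fun k a b hab => ?_, fun a b hab => freeRep_rel K hab⟩
  change freeRep K E (k • a) = freeRep K E (k • b)
  rw [map_smul, map_smul, show freeRep K E a = freeRep K E b from hab]

end

end LeavittPath

/-! ### Adjoint operators and the positivity argument -/

namespace LeavittPathAlgebra

open LeavittPath DirectedGraph

noncomputable section

variable (K : Type w) [Field K] (E : DirectedGraph.{u, v})

/-- The representation of the Leavitt path algebra on the space spanned by the boundary paths. -/
def rep : LeavittPathAlgebra K E →ₙₐ[K] Module.End K (E.BoundaryPath →₀ K) where
  toFun := Quotient.lift (freeRep K E) fun _ _ h => freeRep_con K h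
  map_smul' k a := by
    obtain ⟨a, rfl⟩ := mk_surjective a
    exact map_smul (freeRep K E) k a
  map_zero' := map_zero (freeRep K E)
  map_add' a b := by
    obtain ⟨a, rfl⟩ := mk_surjective a
    obtain ⟨b, rfl⟩ := mk_surjective b
    exact map_add (freeRep K E) a b
  map_mul' a b := by
    obtain ⟨a, rfl⟩ := mk_surjective a
    obtain ⟨b, rfl⟩ := mk_surjective b
    exact map_mul (freeRep K E) a b

variable {K E}

/-- A generator as an element of the Leavitt path algebra. -/
def ofGen (g : Generator E) : LeavittPathAlgebra K E := mk (gen K g)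

theorem rep_ofGen (g : Generator E) : rep K E (ofGen g) = partialOp K g.act :=
  freeRep_gen K g

theorem gen_induction {p : LeavittPathAlgebra K E → Prop} (zero : p 0)
    (add : ∀ a b, p a → p b → p (a + b)) (smul : ∀ (k : K) a, p a → p (k • a))
    (gen : ∀ g, p (ofGen g)) (gen_mul : ∀ g a, p a → p (ofGen g * a)) (a) : p a := by
  obtain ⟨a, rfl⟩ := mk_surjective a
  induction a using MonoidAlgebra.induction_linear with
  | zero => exact zero
  | add a b ha hb => exact add _ _ ha hb
  | single q k =>
    have : (MonoidAlgebra.single q k : FreeAlg K E) = k • MonoidAlgebra.single q 1 := by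
      simp [MonoidAlgebra.smul_single]
    rw [this, mk_smul]
    refine smul _ _ ?_
    clear this
    induction q using FreeSemigroup.recOnMul with
    | ih1 g => exact gen g
    | ih2 g q hg hq =>
      have : (MonoidAlgebra.single (FreeSemigroup.of g * q) 1 : FreeAlg K E) =
          LeavittPath.gen K g * MonoidAlgebra.single q 1 := by
        simp [LeavittPath.gen, MonoidAlgebra.single_mul_single]
      rw [this, mk_mul]
      exact gen_mul _ _ hq

theorem _root_.Module.End.finsupp_apply {X : Type*} (S : Module.End K (X →₀ K)) (a : X →₀ K)
    (s : Finset X) (hs : a.support ⊆ s) (y : X) :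
    S a y = ∑ x ∈ s, a x * S (Finsupp.single x 1) y := by
  have : a = ∑ x ∈ s, a x • Finsupp.single x (1 : K) := by
    conv_lhs => rw [← a.sum_single, Finsupp.sum_of_support_subset a hs _ (by simp)]
    simp
  conv_lhs => rw [this]
  simp only [map_sum, map_smul, Finsupp.finsetSum_apply, Finsupp.smul_apply, smul_eq_mul]

section Involution

variable [StarRing K]

theorem star_ofGen (g : Generator E) :
    star (ofGen g : LeavittPathAlgebra K E) = ofGen g.adjoint := star_mk_gen g

/-- Two operators are adjoint to each other for the form with orthonormal basis `X`. -/
def IsAdjointPair {X : Type*} (S T : Module.End K (X →₀ K)) : Prop :=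
  ∀ x y, S (Finsupp.single x 1) y = star (T (Finsupp.single y 1) x)

theorem IsAdjointPair.mul {X : Type*} {S S' T T' : Module.End K (X →₀ K)}
    (h : IsAdjointPair S T) (h' : IsAdjointPair S' T') : IsAdjointPair (S * S') (T' * T) := by
  classical
  intro x y
  rw [Module.End.mul_apply, Module.End.mul_apply,
    -- Both sums over intermediate basis vectors run over the union of the two supports, so that
    -- they match term by term.
    S.finsupp_apply _ _ Finset.subset_union_left,
    T'.finsupp_apply _ _ Finset.subset_union_right, star_sum]
  refine Finset.sum_congr rfl fun z _ => ?_
  rw [star_mul, h, h']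

theorem isAdjointPair_rep (a : LeavittPathAlgebra K E) :
    IsAdjointPair (rep K E a) (rep K E (star a)) := by
  classical
  have hgen : ∀ g : Generator E,
      IsAdjointPair (rep K E (ofGen g)) (rep K E (star (ofGen g))) := by
    intro g x y
    rw [star_ofGen, rep_ofGen, rep_ofGen, partialOp_single, partialOp_single]
    rcases hx : g.act x with _ | x'
    · rcases hy : g.adjoint.act y with _ | y'
      · simp
      · rw [g.act_adjoint_iff] at hy
        have : y' ≠ x := by rintro rfl; simp [hx] at hy
        simp [this]
    · rcases hy : g.adjoint.act y with _ | y'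
      · have : x' ≠ y := by rintro rfl; simp [g.act_adjoint hx] at hy
        simp [this]
      · have : x' = y ↔ y' = x := by
          constructor
          · rintro rfl; rw [g.act_adjoint hx] at hy; exact (Option.some.inj hy).symm
          · rintro rfl; rw [g.act_adjoint_iff, hx] at hy; exact Option.some.inj hy
        simp [Finsupp.single_apply, this, apply_ite star]
  induction a using gen_induction with
  | zero => intro x y; simp
  | add a b ha hb => intro x y; simp [ha x y, hb x y]
  | smul k a ha => intro x y; simp [ha x y, star_smul]
  | gen g => exact hgen g
  | gen_mul g a ha =>
    rw [star_mul, map_mul, map_mul]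
    exact (hgen g).mul ha

theorem rep_eq_zero_of_sum {n : ℕ} (hK : IsPositiveDefinite K)
    (a : Fin n → LeavittPathAlgebra K E) (h : ∑ i, star (a i) * a i = 0) (i : Fin n) :
    rep K E (a i) = 0 := by
  classical
  refine Finsupp.lhom_ext' fun x => LinearMap.ext_ring ?_
  simp only [LinearMap.comp_apply, Finsupp.lsingle_apply, LinearMap.zero_apply]
  let s : Finset E.BoundaryPath :=
    Finset.univ.biUnion fun i => (rep K E (a i) (Finsupp.single x 1)).support
  have hs : ∀ i, (rep K E (a i) (Finsupp.single x 1)).support ⊆ s := fun i =>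
    Finset.subset_biUnion_of_mem (fun i => (rep K E (a i) (Finsupp.single x 1)).support)
      (Finset.mem_univ i)
  have h0 : ∑ i, ∑ y ∈ s, star (rep K E (a i) (Finsupp.single x 1) y) *
      rep K E (a i) (Finsupp.single x 1) y = 0 := by
    -- Compare the diagonal coefficients at `x`; adjointness turns each into a sum of `star c * c`.
    have := congrArg (fun b => rep K E b (Finsupp.single x 1) x) h
    simp only [map_sum, map_mul, map_zero, LinearMap.sum_apply, Module.End.mul_apply,
      LinearMap.zero_apply, Finsupp.coe_zero, Pi.zero_apply, Finsupp.finsetSum_apply] at this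
    rw [← this]
    refine Finset.sum_congr rfl fun i _ => ?_
    rw [Module.End.finsupp_apply _ _ _ (hs i)]
    refine Finset.sum_congr rfl fun y _ => ?_
    rw [isAdjointPair_rep (a i) x y, star_star, mul_comm]
  ext y
  by_contra hne
  have hy : y ∈ s := hs i (Finsupp.mem_support_iff.2 hne)
  -- The coefficients are indexed by pairs `(i, y)`. They are renumbered to form a single family to
  -- which the hypothesis on `K` applies.
  let e := Fintype.equivFin (Fin n × s)
  have hcard : 0 < Fintype.card (Fin n × s) := Fintype.card_pos_iff.2 ⟨(i, ⟨y, hy⟩)⟩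
  have := hK _ hcard (fun j => rep K E (a (e.symm j).1) (Finsupp.single x 1) (e.symm j).2) (by
    rw [Equiv.sum_comp e.symm fun j : Fin n × s =>
      star (rep K E (a j.1) (Finsupp.single x 1) j.2) * rep K E (a j.1) (Finsupp.single x 1) j.2,
      Fintype.sum_prod_type, ← h0]
    refine Finset.sum_congr rfl fun i _ => ?_
    exact Finset.sum_coe_sort s fun y => star (rep K E (a i) (Finsupp.single x 1) y) *
      rep K E (a i) (Finsupp.single x 1) y) (e (i, ⟨y, hy⟩))
  rw [Equiv.symm_apply_apply] at this
  exact hne this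

end Involution

/-- In every graph a special boundary path starts at `x`, and the vertex `x` fixes it. -/
theorem ofGen_vertex_ne_zero (x : E.Vertex) :
    (ofGen (.vertex x) : LeavittPathAlgebra K E) ≠ 0 := by
  intro h
  have := congrArg (fun b => rep K E b (Finsupp.single (BoundaryPath.special x 0) 1)) h
  simp [rep_ofGen, partialOp_single, Generator.act, BoundaryPath.source_special] at this

end

end LeavittPathAlgebra

/-! ### Finite paths, reduced pairs and initial segments of boundary paths -/

namespace DirectedGraph

variable {E : DirectedGraph.{u, v}}

/-- The source of a path, given by its edges and its range. -/
def pathSource : List E.Edge → E.Vertex → E.Vertex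
  | [], y => y
  | e :: _, _ => E.source e

/-- The edges of `l` form a path with range `y`. -/
def IsPath : List E.Edge → E.Vertex → Prop
  | [], _ => True
  | e :: l, y => E.range e = pathSource l y ∧ IsPath l y

theorem IsPath.range_eq {l : List E.Edge} {e : E.Edge} {y : E.Vertex}
    (h : IsPath (l ++ [e]) y) : E.range e = y := by
  induction l with
  | nil => exact h.1
  | cons f l ih => exact ih h.2

theorem IsPath.init {l : List E.Edge} {e : E.Edge} {y : E.Vertex}
    (h : IsPath (l ++ [e]) y) : IsPath l (E.source e) := by
  induction l with
  | nil => trivial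
  | cons f l ih =>
    refine ⟨?_, ih h.2⟩
    have := h.1
    cases l <;> exact this

theorem IsPath.concat {l : List E.Edge} {e : E.Edge} (h : IsPath l (E.source e)) :
    IsPath (l ++ [e]) (E.range e) := by
  induction l with
  | nil => exact ⟨rfl, trivial⟩
  | cons f l ih =>
    refine ⟨?_, ih h.2⟩
    have := h.1
    cases l <;> exact this

/-- The pairs of paths with common range that do not both end with the same special edge. -/
structure IsReduced (p q : List E.Edge) (y : E.Vertex) : Prop where
  left : IsPath p y
  right : IsPath q y
  ne : ∀ p' q' e, E.IsSpecial e → p = p' ++ [e] → q ≠ q' ++ [e]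

namespace BoundaryPath

open LeavittPath

/-- Remove a given initial path from a boundary path. -/
noncomputable def strip : List E.Edge → E.Vertex → E.BoundaryPath → Option E.BoundaryPath
  | [], y, x => (Generator.vertex y).act x
  | e :: l, y, x => ((Generator.ghost e).act x).bind (strip l y)

/-- The drop in degree records the length of the removed path, which the letters of a periodic
boundary path do not determine. -/
theorem strip_eq_some {l : List E.Edge} {y : E.Vertex} {x x' : E.BoundaryPath}
    (h : strip l y x = some x') :
    x.letters = l.map Sum.inl ++ₛ x'.letters ∧ x.degree = x'.degree + l.length ∧
      x'.source = y := by
  induction l generalizing x with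
  | nil =>
    simp only [strip, Generator.act, Option.ite_none_right_eq_some, Option.some.injEq] at h
    obtain ⟨h, rfl⟩ := h
    exact ⟨rfl, by simp, h⟩
  | cons e l ih =>
    simp only [strip, Generator.act, Option.bind_eq_some_iff, Option.ite_none_right_eq_some,
      Option.some.injEq] at h
    obtain ⟨_, ⟨h, rfl⟩, h'⟩ := h
    obtain ⟨h₁, h₂, h₃⟩ := ih h'
    refine ⟨?_, ?_, h₃⟩
    · rw [List.map_cons, Stream'.cons_append_stream, ← h₁, ← h]
      exact (Stream'.eta _).symm
    · have : x.tail.degree = x.degree - 1 := rfl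
      rw [List.length_cons]
      push_cast
      linarith

/-- The witness is the concatenation of `l` and `x'`; the clause on its source lets the induction
prepend the next edge. -/
theorem exists_strip_eq {l : List E.Edge} {y : E.Vertex} (hl : IsPath l y)
    {x' : E.BoundaryPath} (hx : x'.source = y) :
    ∃ x : E.BoundaryPath, strip l y x = some x' ∧ x.source = pathSource l y := by
  induction l with
  | nil => exact ⟨x', by simp [strip, Generator.act, hx], hx⟩
  | cons e l ih =>
    obtain ⟨x, h, hs⟩ := ih hl.2
    refine ⟨x.cons e (hs.trans hl.1.symm), ?_, rfl⟩
    have : (Generator.ghost e).act (x.cons e (hs.trans hl.1.symm)) = some x := by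
      simp only [Generator.act, tail_cons]
      exact if_pos rfl
    rw [strip, this]
    exact h

end BoundaryPath

theorem _root_.Stream'.exists_append_of_append_eq {α : Type*} {l l' : List α}
    {x x' : Stream' α} (h : l ++ₛ x = l' ++ₛ x') (hl : l.length ≤ l'.length) :
    ∃ m, l' = l ++ m ∧ x = m ++ₛ x' := by
  refine ⟨l'.drop l.length, ?_⟩
  have h₁ : l'.take l.length ++ₛ (l'.drop l.length ++ₛ x') = l ++ₛ x := by
    rw [← Stream'.append_append_stream, List.take_append_drop, h]
  have h₂ := Stream'.append_left_injective _ _ _ _ h₁ (by simpa using hl)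
  rw [h₂] at h₁
  refine ⟨?_, (Stream'.append_right_injective _ _ _ h₁).symm⟩
  conv_lhs => rw [← List.take_append_drop l.length l', h₂]

theorem BoundaryPath.exists_append_of_strip {l l' : List E.Edge} {y y' : E.Vertex}
    {x z z' : E.BoundaryPath} (h : strip l y x = some z) (h' : strip l' y' x = some z')
    (hl : l.length ≤ l'.length) :
    ∃ m, l' = l ++ m ∧ z.letters = m.map Sum.inl ++ₛ z'.letters := by
  obtain ⟨m, h₁, h₂⟩ := Stream'.exists_append_of_append_eq
    ((strip_eq_some h).1.symm.trans (strip_eq_some h').1) (by simpa using hl)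
  obtain ⟨l₁, l₂, rfl, h₃, rfl⟩ := List.map_eq_append_iff.1 h₁
  rw [List.map_inj_right fun _ _ => Sum.inl.inj] at h₃
  exact ⟨l₂, by rw [h₃], h₂⟩

/-- The matrix entries of a reduced monomial detect it among those with longer second path. -/
theorem IsReduced.eq_of_strip {p q p' q' : List E.Edge} {y y' : E.Vertex}
    {x z b : E.BoundaryPath} (h' : IsReduced p' q' y') (hlen : q.length ≤ q'.length)
    (hx : x.strip q y = some (.special y 0)) (hz : z.strip p y = some (.special y 0))
    (hx' : x.strip q' y' = some b) (hz' : z.strip p' y' = some b) :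
    p' = p ∧ q' = q ∧ y' = y := by
  have d₁ := (BoundaryPath.strip_eq_some hx).2.1
  have d₂ := (BoundaryPath.strip_eq_some hz).2.1
  have d₃ := (BoundaryPath.strip_eq_some hx').2.1
  have d₄ := (BoundaryPath.strip_eq_some hz').2.1
  obtain ⟨m, rfl, hm⟩ := BoundaryPath.exists_append_of_strip hx hx' hlen
  -- The degrees of `x` and `z` give `|q'| - |q| = |p'| - |p|`, so `p` is no longer than `p'`.
  obtain ⟨n, rfl, hn⟩ := BoundaryPath.exists_append_of_strip hz hz' (by omega)
  simp only [List.length_append] at d₃ d₄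
  have hmn : m = n := by
    have := Stream'.append_left_injective _ _ _ _ (hm.symm.trans hn) (by simp; omega)
    rwa [List.map_inj_right fun _ _ => Sum.inl.inj] at this
  subst hmn
  rcases List.eq_nil_or_concat m with rfl | ⟨m, e, rfl⟩
  · refine ⟨by simp, by simp, ?_⟩
    rw [← (BoundaryPath.strip_eq_some hx').2.2, ← BoundaryPath.source_special y 0,
      BoundaryPath.source, BoundaryPath.source, hm]
    rfl
  · exfalso
    -- Both paths now end with `e`, which is a letter of the special boundary path and therefore
    -- special, against reducedness.
    refine h'.ne (p ++ m) (q ++ m) e ?_ (by simp) (by simp)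
    refine BoundaryPath.isSpecial_of_get_special (y := y) (m := 0) (n := m.length) ?_
    rw [hm]
    have := Stream'.get_append_length (m.map Sum.inl) (Stream'.cons (Sum.inl e) b.letters)
    simpa [Stream'.append_append_stream] using this

end DirectedGraph

/-! ### Spanning by reduced monomials -/

namespace LeavittPathAlgebra

open LeavittPath DirectedGraph

noncomputable section

variable {K : Type w} [Field K] {E : DirectedGraph.{u, v}}

theorem mk_eq_of_rel {a b : FreeAlg K E} (h : Rel K a b) :
    (mk a : LeavittPathAlgebra K E) = mk b :=
  mk_eq_mk.2 ((con_isAdmissible K).2 _ _ h)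

/-- A vertex as an element of the Leavitt path algebra. -/
abbrev ofVertex (y : E.Vertex) : LeavittPathAlgebra K E := ofGen (.vertex y)

/-- An edge as an element of the Leavitt path algebra. -/
abbrev ofEdge (e : E.Edge) : LeavittPathAlgebra K E := ofGen (.edge e)

/-- A ghost edge as an element of the Leavitt path algebra. -/
abbrev ofGhost (e : E.Edge) : LeavittPathAlgebra K E := ofGen (.ghost e)

theorem vertex_mul_self (y : E.Vertex) :
    (ofVertex y * ofVertex y : LeavittPathAlgebra K E) = ofVertex y :=
  mk_eq_of_rel (.vertex_self y)

theorem vertex_mul_of_ne {y z : E.Vertex} (h : y ≠ z) :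
    (ofVertex y * ofVertex z : LeavittPathAlgebra K E) = 0 :=
  mk_eq_of_rel (.vertex_ne y z h)

theorem source_mul_edge (e : E.Edge) :
    (ofVertex (E.source e) * ofEdge e : LeavittPathAlgebra K E) = ofEdge e :=
  mk_eq_of_rel (.source_edge e)

theorem edge_mul_range (e : E.Edge) :
    (ofEdge e * ofVertex (E.range e) : LeavittPathAlgebra K E) = ofEdge e :=
  mk_eq_of_rel (.edge_range e)

theorem range_mul_ghost (e : E.Edge) :
    (ofVertex (E.range e) * ofGhost e : LeavittPathAlgebra K E) = ofGhost e :=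
  mk_eq_of_rel (.range_ghost e)

theorem ghost_mul_source (e : E.Edge) :
    (ofGhost e * ofVertex (E.source e) : LeavittPathAlgebra K E) = ofGhost e :=
  mk_eq_of_rel (.ghost_source e)

theorem ghost_mul_edge_self (e : E.Edge) :
    (ofGhost e * ofEdge e : LeavittPathAlgebra K E) = ofVertex (E.range e) :=
  mk_eq_of_rel (.ck1_self e)

theorem ghost_mul_edge_of_ne {e f : E.Edge} (h : e ≠ f) :
    (ofGhost e * ofEdge f : LeavittPathAlgebra K E) = 0 :=
  mk_eq_of_rel (.ck1_ne e f h)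

theorem vertex_eq_sum {y : E.Vertex} (h : E.IsRegular y) :
    (ofVertex y : LeavittPathAlgebra K E) = ∑ e ∈ h.1.toFinset, ofEdge e * ofGhost e :=
  (mk_eq_of_rel (.ck2 y h.1 h.2)).trans
    (map_sum (AddMonoidHom.mk' (mk : FreeAlg K E → LeavittPathAlgebra K E) mk_add) _ _)

/-- A path as an element of the Leavitt path algebra. -/
def ofPath : List E.Edge → E.Vertex → LeavittPathAlgebra K E
  | [], y => ofVertex y
  | e :: l, y => ofEdge e * ofPath l y

theorem pathSource_mul_ofPath (l : List E.Edge) (y : E.Vertex) :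
    (ofVertex (pathSource l y) * ofPath l y : LeavittPathAlgebra K E) = ofPath l y := by
  cases l with
  | nil => exact vertex_mul_self y
  | cons e l => rw [ofPath, pathSource, ← mul_assoc, source_mul_edge]

theorem vertex_mul_ofPath_of_ne {l : List E.Edge} {y z : E.Vertex} (h : z ≠ pathSource l y) :
    (ofVertex z * ofPath l y : LeavittPathAlgebra K E) = 0 := by
  rw [← pathSource_mul_ofPath, ← mul_assoc, vertex_mul_of_ne h, zero_mul]

theorem ofPath_eq_zero {l : List E.Edge} {y : E.Vertex} (h : ¬ IsPath l y) :
    (ofPath l y : LeavittPathAlgebra K E) = 0 := by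
  induction l with
  | nil => exact absurd trivial h
  | cons e l ih =>
    rw [ofPath]
    by_cases hl : IsPath l y
    · rw [← edge_mul_range, mul_assoc, vertex_mul_ofPath_of_ne fun h' => h ⟨h', hl⟩, mul_zero]
    · rw [ih hl, mul_zero]

theorem ofPath_concat (l : List E.Edge) (e : E.Edge) :
    (ofPath (l ++ [e]) (E.range e) : LeavittPathAlgebra K E) =
      ofPath l (E.source e) * ofEdge e := by
  induction l with
  | nil => exact (edge_mul_range e).trans (source_mul_edge e).symm
  | cons f l ih => rw [List.cons_append, ofPath, ofPath, ih, mul_assoc]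

variable [StarRing K]

/-- The element `p q⋆` of the Leavitt path algebra for paths `p`, `q` with range `y`. -/
def monomial (p q : List E.Edge) (y : E.Vertex) : LeavittPathAlgebra K E :=
  ofPath p y * star (ofPath q y)

theorem monomial_cons (e : E.Edge) (p q : List E.Edge) (y : E.Vertex) :
    (monomial (e :: p) q y : LeavittPathAlgebra K E) = ofEdge e * monomial p q y :=
  mul_assoc _ _ _

theorem monomial_concat_concat (p q : List E.Edge) (e : E.Edge) :
    (monomial (p ++ [e]) (q ++ [e]) (E.range e) : LeavittPathAlgebra K E) =
      ofPath p (E.source e) * (ofEdge e * ofGhost e) * star (ofPath q (E.source e)) := by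
  rw [monomial, ofPath_concat, ofPath_concat, star_mul, star_ofGen, Generator.adjoint]
  simp only [mul_assoc]

theorem monomial_nil_concat (q : List E.Edge) (e : E.Edge) :
    (monomial [] (q ++ [e]) (E.range e) : LeavittPathAlgebra K E) =
      ofGhost e * star (ofPath q (E.source e)) := by
  rw [monomial, ofPath_concat, star_mul, star_ofGen, Generator.adjoint, ofPath, ← mul_assoc,
    range_mul_ghost]

theorem vertex_mul_monomial (z : E.Vertex) (p q : List E.Edge) (y : E.Vertex) :
    (ofVertex z * monomial p q y : LeavittPathAlgebra K E) = monomial p q y ∨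
      (ofVertex z * monomial p q y : LeavittPathAlgebra K E) = 0 := by
  rw [monomial, ← mul_assoc]
  by_cases h : z = pathSource p y
  · left; rw [h, pathSource_mul_ofPath]
  · right; rw [vertex_mul_ofPath_of_ne h, zero_mul]

/-- By (CK1), a ghost edge cancels the first edge of `p` or kills the monomial; if `p` has no edges,
it is absorbed into `q⋆` or gives zero. -/
theorem ghost_mul_monomial (e : E.Edge) (p q : List E.Edge) (y : E.Vertex) :
    (∃ p' q' y', (ofGhost e * monomial p q y : LeavittPathAlgebra K E) = monomial p' q' y') ∨
      (ofGhost e * monomial p q y : LeavittPathAlgebra K E) = 0 := by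
  cases p with
  | nil =>
    by_cases h : E.source e = y
    · subst h
      exact .inl ⟨[], q ++ [e], E.range e, by
        rw [monomial_nil_concat, monomial, ofPath, ← mul_assoc, ghost_mul_source]⟩
    · right
      rw [monomial, ofPath, ← ghost_mul_source, mul_assoc, ← mul_assoc (ofVertex _),
        vertex_mul_of_ne h, zero_mul, mul_zero]
  | cons f p =>
    rw [monomial_cons, ← mul_assoc]
    by_cases h : e = f
    · subst h
      rw [ghost_mul_edge_self]
      exact (vertex_mul_monomial _ p q y).imp_left fun h => ⟨p, q, y, h⟩
    · right; rw [ghost_mul_edge_of_ne h, zero_mul]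

theorem mem_span_monomial (a : LeavittPathAlgebra K E) :
    a ∈ Submodule.span K {b | ∃ p q y, monomial p q y = b} := by
  have hmon : ∀ p q y, (monomial p q y : LeavittPathAlgebra K E) ∈
      Submodule.span K {b | ∃ p q y, monomial p q y = b} :=
    fun p q y => Submodule.subset_span ⟨p, q, y, rfl⟩
  induction a using gen_induction with
  | zero => exact zero_mem _
  | add a b ha hb => exact add_mem ha hb
  | smul k a ha => exact Submodule.smul_mem _ k ha
  | gen g =>
    cases g with
    | vertex y =>
      have := hmon [] [] y
      rwa [monomial, ofPath, star_ofGen, Generator.adjoint, vertex_mul_self] at this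
    | edge e =>
      have := hmon [e] [] (E.range e)
      rwa [monomial, ofPath, ofPath, ofPath, star_ofGen, Generator.adjoint, edge_mul_range,
        edge_mul_range] at this
    | ghost e =>
      have := hmon [] ([] ++ [e]) (E.range e)
      rwa [monomial_nil_concat, ofPath, star_ofGen, Generator.adjoint, ghost_mul_source] at this
  | gen_mul g a ha =>
    induction ha using Submodule.span_induction with
    | zero => rw [mul_zero]; exact zero_mem _
    | add a b _ _ ha hb => rw [mul_add]; exact add_mem ha hb
    | smul k a _ ha => rw [mul_smul_comm]; exact Submodule.smul_mem _ k ha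
    | mem a ha =>
      obtain ⟨p, q, y, rfl⟩ := ha
      cases g with
      | vertex z =>
        rcases vertex_mul_monomial (K := K) z p q y with h | h
        · rw [h]; exact hmon _ _ _
        · rw [h]; exact zero_mem _
      | edge e => rw [← monomial_cons]; exact hmon _ _ _
      | ghost e =>
        rcases ghost_mul_monomial (K := K) e p q y with ⟨p', q', y', h⟩ | h
        · rw [h]; exact hmon _ _ _
        · rw [h]; exact zero_mem _

/-- Induction on the length of `p`. If both paths end with a special edge `e`, (CK2) at its source
rewrites the monomial as a shorter one minus the monomials ending with the other edges `f` from that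
vertex. The latter are already reduced, since a vertex emits at most one special edge. -/
theorem monomial_mem_span_reduced (p q : List E.Edge) (y : E.Vertex) :
    (monomial p q y : LeavittPathAlgebra K E) ∈
      Submodule.span K {b | ∃ p q y, IsReduced p q y ∧ monomial p q y = b} := by
  classical
  induction h : p.length generalizing p q y with
  | zero =>
    obtain rfl := List.length_eq_zero_iff.1 h
    by_cases hq : IsPath q y
    · exact Submodule.subset_span ⟨[], q, y, ⟨trivial, hq, fun _ _ _ _ h => by simp at h⟩, rfl⟩
    · rw [monomial, ofPath_eq_zero hq, star_zero, mul_zero]; exact zero_mem _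
  | succ n ih =>
    by_cases hp : IsPath p y
    swap
    · rw [monomial, ofPath_eq_zero hp, zero_mul]; exact zero_mem _
    by_cases hq : IsPath q y
    swap
    · rw [monomial, ofPath_eq_zero hq, star_zero, mul_zero]; exact zero_mem _
    by_cases hred : IsReduced p q y
    · exact Submodule.subset_span ⟨p, q, y, hred, rfl⟩
    obtain ⟨p', q', e, he, rfl, rfl⟩ : ∃ p' q' e, E.IsSpecial e ∧ p = p' ++ [e] ∧
        q = q' ++ [e] := by
      by_contra hne
      exact hred ⟨hp, hq, fun p' q' e he h₁ h₂ => hne ⟨p', q', e, he, h₁, h₂⟩⟩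
    obtain rfl := hp.range_eq
    have hreg := he.1
    have hmem : e ∈ hreg.1.toFinset := by simp
    have key : (monomial (p' ++ [e]) (q' ++ [e]) (E.range e) : LeavittPathAlgebra K E) =
        monomial p' q' (E.source e) -
          ∑ f ∈ hreg.1.toFinset.erase e, monomial (p' ++ [f]) (q' ++ [f]) (E.range f) := by
      have h₁ : (ofPath p' (E.source e) * ofVertex (E.source e) *
          star (ofPath q' (E.source e)) : LeavittPathAlgebra K E) =
          ∑ f ∈ hreg.1.toFinset, monomial (p' ++ [f]) (q' ++ [f]) (E.range f) := by
        rw [vertex_eq_sum hreg, Finset.mul_sum, Finset.sum_mul]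
        refine Finset.sum_congr rfl fun f hf => ?_
        have hf : E.source f = E.source e := by simpa using hf
        rw [monomial_concat_concat, hf]
      have h₂ : (ofPath p' (E.source e) * ofVertex (E.source e) : LeavittPathAlgebra K E) =
          ofPath p' (E.source e) := by
        generalize E.source e = z
        clear * -
        induction p' with
        | nil => exact vertex_mul_self z
        | cons f p' ih => rw [ofPath, mul_assoc, ih]
      rw [h₂, ← Finset.add_sum_erase _ _ hmem] at h₁
      rw [monomial.eq_def p' q', h₁, add_sub_cancel_right]
    rw [key]
    refine sub_mem (ih _ _ _ (by simpa using h)) (sum_mem fun f hf => ?_)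
    obtain ⟨hfe, hf⟩ := Finset.mem_erase.1 hf
    have hf : E.source f = E.source e := by simpa using hf
    refine Submodule.subset_span ⟨_, _, _, ⟨?_, ?_, ?_⟩, rfl⟩
    · exact (hf ▸ hp.init).concat
    · exact (hf ▸ hq.init).concat
    · intro p'' q'' g hg h₁ _
      obtain rfl : f = g := by simpa using (List.append_inj' h₁ rfl).2
      exact hfe (hg.eq_of_source_eq he hf)

/-! ### Matrix entries of monomials and faithfulness -/

theorem rep_star_ofPath (l : List E.Edge) (y : E.Vertex) :
    rep K E (star (ofPath l y)) = partialOp K (BoundaryPath.strip l y) := by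
  induction l with
  | nil => rw [ofPath, star_ofGen, rep_ofGen]; rfl
  | cons e l ih =>
    rw [ofPath, star_mul, star_ofGen, map_mul, ih, rep_ofGen]
    refine Finsupp.lhom_ext' fun x => LinearMap.ext_ring ?_
    simp only [LinearMap.comp_apply, Finsupp.lsingle_apply, Module.End.mul_apply,
      partialOp_single, BoundaryPath.strip, Generator.adjoint]
    rcases (Generator.ghost e).act x with _ | x'
    · simp
    · simp [partialOp_single]

/-- Prepending `p` is never computed directly: by adjointness, the entry of `p q⋆` at `x`, `z`
compares what is left of `x` after removing `q` with what is left of `z` after removing `p`. -/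
theorem rep_monomial_apply_eq_one {p q : List E.Edge} {y : E.Vertex} {x z b : E.BoundaryPath}
    (hx : x.strip q y = some b) (hz : z.strip p y = some b) :
    rep K E (monomial p q y) (Finsupp.single x 1) z = 1 := by
  rw [monomial, map_mul, Module.End.mul_apply, rep_star_ofPath, partialOp_single_some hx,
    isAdjointPair_rep, rep_star_ofPath, partialOp_single_some hz]
  simp

theorem exists_strip_of_rep_monomial_apply_ne_zero {p q : List E.Edge} {y : E.Vertex}
    {x z : E.BoundaryPath} (h : rep K E (monomial p q y) (Finsupp.single x 1) z ≠ 0) :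
    ∃ b, x.strip q y = some b ∧ z.strip p y = some b := by
  rw [monomial, map_mul, Module.End.mul_apply, rep_star_ofPath] at h
  rcases hx : x.strip q y with _ | b
  · simp [partialOp_single_none hx] at h
  · refine ⟨b, rfl, ?_⟩
    rw [partialOp_single_some hx, isAdjointPair_rep, rep_star_ofPath] at h
    rcases hz : z.strip p y with _ | b'
    · simp [partialOp_single_none hz] at h
    · rw [partialOp_single_some hz] at h
      by_contra hne
      have : b' ≠ b := fun hb => hne (by rw [hb])
      simp [this] at h

theorem eq_zero_of_rep_eq_zero {a : LeavittPathAlgebra K E} (ha : rep K E a = 0) : a = 0 := by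
  classical
  let I := {i : List E.Edge × List E.Edge × E.Vertex // IsReduced i.1 i.2.1 i.2.2}
  let m : I → LeavittPathAlgebra K E := fun i => monomial i.1.1 i.1.2.1 i.1.2.2
  have hmem : a ∈ Submodule.span K (Set.range m) := by
    have hle : Submodule.span K {b : LeavittPathAlgebra K E | ∃ p q y, monomial p q y = b} ≤
        Submodule.span K (Set.range m) := by
      rw [Submodule.span_le]
      rintro _ ⟨p, q, y, rfl⟩
      refine Submodule.span_mono ?_ (monomial_mem_span_reduced p q y)
      rintro _ ⟨p, q, y, h, rfl⟩
      exact ⟨⟨(p, q, y), h⟩, rfl⟩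
    exact hle (mem_span_monomial a)
  obtain ⟨c, rfl⟩ := Finsupp.mem_span_range_iff_exists_finsupp.1 hmem
  by_cases hc : c = 0
  · simp [hc]
  exfalso
  -- Minimality of `q` makes it an initial part of any `q'` in the support that can be removed from
  -- the same boundary path.
  obtain ⟨i, hi, hmin⟩ := c.support.exists_min_image (fun i => i.1.2.1.length)
    (Finsupp.support_nonempty_iff.2 hc)
  obtain ⟨⟨p, q, y⟩, hr⟩ := i
  obtain ⟨x, hx, -⟩ := BoundaryPath.exists_strip_eq hr.right (BoundaryPath.source_special y 0)
  obtain ⟨z, hz, -⟩ := BoundaryPath.exists_strip_eq hr.left (BoundaryPath.source_special y 0)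
  have h0 := congrArg (fun T => T (Finsupp.single x 1) z) ha
  simp only [Finsupp.sum, map_sum, map_smul, LinearMap.sum_apply, LinearMap.smul_apply,
    Finsupp.finsetSum_apply, Finsupp.smul_apply, LinearMap.zero_apply, Finsupp.coe_zero,
    Pi.zero_apply, smul_eq_mul] at h0
  -- At the entry given by `x = q t` and `z = p t`, with `t` special, only the chosen monomial
  -- contributes, so its coefficient vanishes.
  rw [Finset.sum_eq_single_of_mem _ hi, rep_monomial_apply_eq_one hx hz, mul_one] at h0
  · exact Finsupp.mem_support_iff.1 hi h0
  · rintro ⟨⟨p', q', y'⟩, hr'⟩ hi' hne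
    by_contra h
    obtain ⟨b, hx', hz'⟩ :=
      exists_strip_of_rep_monomial_apply_ne_zero (right_ne_zero_of_mul h)
    obtain ⟨rfl, rfl, rfl⟩ := hr'.eq_of_strip (hmin _ hi') hx hz hx' hz'
    exact hne rfl

/-- If `K` is positive definite, then so is every Leavitt path algebra over `K`. -/
theorem isPositiveDefinite (hK : IsPositiveDefinite K) (E : DirectedGraph.{u, v}) :
    IsPositiveDefinite (LeavittPathAlgebra K E) :=
  fun _ _ a h i => eq_zero_of_rep_eq_zero (rep_eq_zero_of_sum hK a h i)

/-- If some Leavitt path algebra of a nonempty graph is positive definite, so is `K`. -/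
theorem isPositiveDefinite_of_nonempty [hE : Nonempty E.Vertex]
    (h : IsPositiveDefinite (LeavittPathAlgebra K E)) : IsPositiveDefinite K := by
  intro n hn k hk i
  obtain ⟨y⟩ := hE
  have := h n hn (fun i => k i • ofVertex y) (by
    have hterm : ∀ i, star (k i • ofVertex y : LeavittPathAlgebra K E) * (k i • ofVertex y) =
        (star (k i) * k i) • ofVertex y := by
      intro i
      rw [star_smul, star_ofGen, Generator.adjoint, smul_mul_smul_comm, vertex_mul_self]
    simp only [hterm, ← Finset.sum_smul, hk, zero_smul]) i
  exact (smul_eq_zero.1 this).resolve_right (ofGen_vertex_ne_zero y)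

end

end LeavittPathAlgebra

theorem proposition2p4 (K : Type w) [Field K] [StarRing K] :
    List.TFAE
      [IsPositiveDefinite K,
        ∀ E : DirectedGraph.{u, v}, IsPositiveDefinite (LeavittPathAlgebra K E),
        ∃ E : DirectedGraph.{u, v}, Nonempty E.Vertex ∧
          IsPositiveDefinite (LeavittPathAlgebra K E)] ∧
    ∀ E : DirectedGraph.{u, v}, Nonempty E.Vertex →
      (IsPositiveDefinite (LeavittPathAlgebra K E) ↔ IsPositiveDefinite K) := by
  refine ⟨?_, fun E _ => ⟨LeavittPathAlgebra.isPositiveDefinite_of_nonempty,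
    fun h => LeavittPathAlgebra.isPositiveDefinite h E⟩⟩
  tfae_have 1 → 2 := LeavittPathAlgebra.isPositiveDefinite
  tfae_have 2 → 3 := fun h =>
    ⟨⟨PUnit, PEmpty, PEmpty.elim, PEmpty.elim⟩, ⟨⟨⟩⟩, h _⟩
  tfae_have 3 → 1 := fun ⟨_, _, h⟩ => LeavittPathAlgebra.isPositiveDefinite_of_nonempty h
  tfae_finish
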